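/- Let $\Bbbk$ be an algebraically closed field and let $G$ be a connected affine algebraic group over $\Bbbk$ with algebra of polynomial functions $\Bbbk[G]$. For $x\in G$ and $f\in\Bbbk[G]$ let $x\cdot f\in\Bbbk[G]$ be the translate $(x\cdot f)(y)=f(yx)$, $y \in G$. Let $\mathfrak H$ be the set of all closed subgroups of $G$ and $\mathfrak R$ the set of all $\Bbbk$-subalgebras of $\Bbbk[G]$, both ordered by inclusion, and consider the maps $$\mathfrak H\to\mathfrak R,\quad H\mapsto H'={}^H\Bbbk[G]=\{f\in\Bbbk[G]: x\cdot f=f\ \text{ for all } x\in H\},$$ $$\mathfrak R\to\mathfrak H,\quad R\mapsto R'=\operatorname{Stab}(R)=\{x\in G: x\cdot r=r\ \text{ for all } r\in R\}.$$ A closed subgroup $H\subseteq G$ is called observable in $G$ if every finite dimensional rational $H$-module is isomorphic to an $H$-submodule of (the restriction to $H$ of) some finite dimensional rational $G$-module. Then these two maps form an order-inverting Galois connection, that is, $R\subseteq H'$ if and only if $H\subseteq R'$, for all $H\in\mathfrak H$ and $R\in\mathfrak R$. Moreover, the closed subgroups $H$ with $H''=H$ are exactly the observable subgroups of $G$. 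-/

import Mathlib

universe u v w

/-- The structure of an affine algebraic group over `k` on an abstract group `G`
(in the classical sense, `k` being algebraically closed in the applications).
It is given by the algebra `k[G]` of polynomial functions on `G`: a finitely generated algebra of
`k`-valued functions such that `G` is identified, through evaluation, with the set of all
`k`-algebra homomorphisms `k[G] → k` (that is, `(G, k[G])` is an affine variety), and such that
multiplication `G × G → G` and inversion `G → G` are morphisms of affine varieties. -/
structure AffineAlgebraicGroup (k : Type u) (G : Type v) [Field k] [Group G] where
  /-- the algebra `k[G]` of polynomial functions -/
  coordRing : Subalgebra k (G → k)
  fg : coordRing.FG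
  bijective_eval :
    Function.Bijective (fun x : G => (Pi.evalAlgHom k (fun _ : G => k) x).comp coordRing.val)
  mul_mem : ∀ f ∈ coordRing, ∃ (n : ℕ) (f₁ f₂ : Fin n → coordRing),
    ∀ x y : G, f (x * y) = ∑ i, (f₁ i : G → k) x * (f₂ i : G → k) y
  inv_mem : ∀ f ∈ coordRing, (fun x => f x⁻¹) ∈ coordRing

namespace AffineAlgebraicGroup

section Basic

variable {k : Type u} {G : Type v} [Field k] [Group G] (𝔾 : AffineAlgebraicGroup k G)

/-- The set of common zeros in `G` of a set `S` of polynomial functions. -/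
def zeroLocus (S : Set 𝔾.coordRing) : Set G := {x | ∀ f ∈ S, (f : G → k) x = 0}

/-- The Zariski topology of `G`: the closed sets are the zero loci of sets of polynomial
functions. -/
abbrev zariskiTopology : TopologicalSpace G :=
  TopologicalSpace.ofClosed {Z | ∃ S, Z = 𝔾.zeroLocus S}
    ⟨{1}, by ext x; simp [zeroLocus]⟩
    (by
      intro A hA
      refine ⟨{f | ∃ Z ∈ A, ∀ x ∈ Z, (f : G → k) x = 0}, ?_⟩
      ext x
      constructor
      · rintro hx f ⟨Z, hZ, hf⟩
        exact hf x (hx Z hZ)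
      · intro hx Z hZ
        obtain ⟨S, rfl⟩ := hA hZ
        exact fun f hf => hx f ⟨_, hZ, fun y hy => hy f hf⟩)
    (by
      rintro _ ⟨S, rfl⟩ _ ⟨T, rfl⟩
      refine ⟨{h | ∃ f ∈ S, ∃ g ∈ T, h = f * g}, ?_⟩
      ext x
      constructor
      · rintro (hx | hx)
        · rintro _ ⟨f, hf, g, hg, rfl⟩
          simp [hx f hf]
        · rintro _ ⟨f, hf, g, hg, rfl⟩
          simp [hx g hg]
      · intro hx
        by_contra hcon
        have h1 : ¬ ∀ f ∈ S, (f : G → k) x = 0 := fun h => hcon (Or.inl h)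
        have h2 : ¬ ∀ g ∈ T, (g : G → k) x = 0 := fun h => hcon (Or.inr h)
        push Not at h1 h2
        obtain ⟨f, hf, hf0⟩ := h1
        obtain ⟨g, hg, hg0⟩ := h2
        have := hx (f * g) ⟨f, hf, g, hg, rfl⟩
        simp [hf0, hg0] at this)

theorem isClosed_iff (Z : Set G) :
    @IsClosed G 𝔾.zariskiTopology Z ↔ ∃ S, Z = 𝔾.zeroLocus S := by
  rw [← @isOpen_compl_iff G Z 𝔾.zariskiTopology]
  change Zᶜᶜ ∈ _ ↔ _
  rw [compl_compl]
  rfl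

/-- `G` is connected, in its Zariski topology. -/
def IsConnected : Prop := @ConnectedSpace G 𝔾.zariskiTopology

/-- The set `𝓗` of all closed subgroups of `G`, ordered by inclusion. -/
abbrev ClosedSubgroup : Type v :=
  {H : Subgroup G // @IsClosed G 𝔾.zariskiTopology (H : Set G)}

/-- The algebra homomorphism `f ↦ x · f` of `k[G]`, where `(x · f) y = f (y x)`. -/
def translate (x : G) : 𝔾.coordRing →ₐ[k] 𝔾.coordRing where
  toFun f := ⟨fun y => (f : G → k) (y * x), by
    obtain ⟨n, f₁, f₂, h⟩ := 𝔾.mul_mem f f.2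
    have : (fun y => (f : G → k) (y * x)) =
        ∑ i, (f₂ i : G → k) x • (f₁ i : G → k) := by
      ext y
      simp [h, mul_comm]
    rw [this]
    exact Subalgebra.sum_mem _ fun i _ => Subalgebra.smul_mem _ (f₁ i).2 _⟩
  map_one' := rfl
  map_mul' _ _ := rfl
  map_zero' := rfl
  map_add' _ _ := rfl
  commutes' _ := rfl

@[simp]
theorem translate_apply (x y : G) (f : 𝔾.coordRing) :
    (𝔾.translate x f : G → k) y = (f : G → k) (y * x) := rfl

/-- The functions `y ↦ f (x y)` are polynomial. -/
theorem comp_mul_left_mem (x : G) (f : 𝔾.coordRing) :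
    (fun y => (f : G → k) (x * y)) ∈ 𝔾.coordRing := by
  obtain ⟨n, f₁, f₂, h⟩ := 𝔾.mul_mem f f.2
  have : (fun y => (f : G → k) (x * y)) = ∑ i, (f₁ i : G → k) x • (f₂ i : G → k) := by
    ext y
    simp [h]
  rw [this]
  exact Subalgebra.sum_mem _ fun i _ => Subalgebra.smul_mem _ (f₂ i).2 _

/-- The map `𝔽 : H ↦ H' = ᴴk[G] = {f ∈ k[G] : x · f = f for all x ∈ H}`. -/
def fixedSubalgebra (H : 𝔾.ClosedSubgroup) : Subalgebra k 𝔾.coordRing where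
  carrier := {f | ∀ x ∈ H.1, 𝔾.translate x f = f}
  mul_mem' hf hg x hx := by rw [map_mul, hf x hx, hg x hx]
  add_mem' hf hg x hx := by rw [map_add, hf x hx, hg x hx]
  algebraMap_mem' r x _ := (𝔾.translate x).commutes r

/-- The map `𝕊 : R ↦ R' = Stab(R) = {x ∈ G : x · r = r for all r ∈ R}`. -/
def stab (R : Subalgebra k 𝔾.coordRing) : 𝔾.ClosedSubgroup :=
  ⟨{ carrier := {x | ∀ r ∈ R, 𝔾.translate x r = r}
     one_mem' := fun r _ => by ext y; simp
     mul_mem' := fun {a b} ha hb r hr => by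
      ext y
      have h1 := congrFun (congrArg Subtype.val (hb r hr)) (y * a)
      have h2 := congrFun (congrArg Subtype.val (ha r hr)) y
      simp only [translate_apply] at h1 h2 ⊢
      rw [← mul_assoc, h1, h2]
     inv_mem' := fun {a} ha r hr => by
      ext y
      have h := congrFun (congrArg Subtype.val (ha r hr)) (y * a⁻¹)
      simp only [translate_apply] at h ⊢
      rw [← h, inv_mul_cancel_right] },
   by
    rw [isClosed_iff]
    refine ⟨{f | ∃ r ∈ R, ∃ y : G, ∀ x, (f : G → k) x = (r : G → k) (y * x) - (r : G → k) y}, ?_⟩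
    ext x
    constructor
    · rintro hx f ⟨r, hr, y, hf⟩
      have h := congrFun (congrArg Subtype.val (hx r hr)) y
      simp only [translate_apply] at h
      rw [hf, h, sub_self]
    · intro hx r hr
      ext y
      have hmem := Subalgebra.sub_mem _ (𝔾.comp_mul_left_mem y r)
        (𝔾.coordRing.algebraMap_mem ((r : G → k) y))
      exact sub_eq_zero.1 (hx ⟨_, hmem⟩ ⟨r, hr, y, fun _ => rfl⟩)⟩

/-- A representation of `G` on a `k`-module `M`, not necessarily finite dimensional, is rational
when it comes from a coaction `M → M ⊗ k[G]`, `m ↦ ∑ mᵢ ⊗ fᵢ`, through `x · m = ∑ fᵢ(x) mᵢ`. -/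
def IsRational {M : Type w} [AddCommGroup M] [Module k M] (ρ : Representation k G M) : Prop :=
  ∀ m : M, ∃ (n : ℕ) (m' : Fin n → M) (f : Fin n → 𝔾.coordRing),
    ∀ x : G, ρ x m = ∑ i, (f i : G → k) x • m' i

/-- Restriction of functions from `G` to a subgroup `H`. -/
def restrict (H : Subgroup G) : (G → k) →ₐ[k] (H → k) where
  toFun f x := f x
  map_one' := rfl
  map_mul' _ _ := rfl
  map_zero' := rfl
  map_add' _ _ := rfl
  commutes' _ := rfl

/-- A closed subgroup `H` of `G` as an affine algebraic group: `k[H]` consists of the restrictions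
to `H` of the elements of `k[G]`. -/
def toAffineAlgebraicGroup (H : 𝔾.ClosedSubgroup) : AffineAlgebraicGroup k H.1 where
  coordRing := 𝔾.coordRing.map (restrict H.1)
  fg := 𝔾.fg.map _
  bijective_eval := by
    constructor
    · intro x y hxy
      apply Subtype.ext
      apply 𝔾.bijective_eval.1
      ext f
      exact DFunLike.congr_fun hxy ⟨restrict H.1 f, f, f.2, rfl⟩
    · intro φ
      let π : 𝔾.coordRing →ₐ[k] (𝔾.coordRing.map (restrict H.1)) :=
        ((restrict H.1).comp 𝔾.coordRing.val).codRestrict _ fun f => ⟨f, f.2, rfl⟩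
      obtain ⟨x, hx⟩ := 𝔾.bijective_eval.2 (φ.comp π)
      have hx' : ∀ f : 𝔾.coordRing, (f : G → k) x = φ (π f) := fun f => DFunLike.congr_fun hx f
      have hxH : x ∈ H.1 := by
        obtain ⟨S, hS⟩ := (𝔾.isClosed_iff _).1 H.2
        change x ∈ (H.1 : Set G)
        rw [hS]
        intro f hf
        have h0 : π f = 0 := by
          ext y
          have hy : (y : G) ∈ (H.1 : Set G) := y.2
          rw [hS] at hy
          exact hy f hf
        rw [hx', h0, map_zero]
      refine ⟨⟨x, hxH⟩, ?_⟩
      ext ⟨_, f, hf, rfl⟩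
      exact hx' ⟨f, hf⟩
  mul_mem := by
    rintro _ ⟨f, hf, rfl⟩
    obtain ⟨n, f₁, f₂, h⟩ := 𝔾.mul_mem f hf
    exact ⟨n, fun i => ⟨restrict H.1 (f₁ i), f₁ i, (f₁ i).2, rfl⟩,
      fun i => ⟨restrict H.1 (f₂ i), f₂ i, (f₂ i).2, rfl⟩, fun x y => h x y⟩
  inv_mem := by
    rintro _ ⟨f, hf, rfl⟩
    exact ⟨_, 𝔾.inv_mem f hf, rfl⟩

/-- A closed subgroup `H` is observable in `G` when every finite dimensional rational
representation `σ` of `H` can be extended to a finite dimensional rational representation `ρ`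
of `G`: there is an injective `H`-equivariant linear map from the first into the restriction to
`H` of the second. (Every finite dimensional space over `k` has a copy in the universe of `k`.) -/
def IsObservable (H : 𝔾.ClosedSubgroup) : Prop :=
  ∀ (M : Type u) [AddCommGroup M] [Module k M] [Module.Finite k M] (σ : Representation k H.1 M),
    (𝔾.toAffineAlgebraicGroup H).IsRational σ →
    ∃ (N : Type u) (_ : AddCommGroup N) (_ : Module k N) (_ : Module.Finite k N)
      (ρ : Representation k G N) (ι : M →ₗ[k] N),
      𝔾.IsRational ρ ∧ Function.Injective ι ∧ ∀ (x : H.1) (m : M), ι (σ x m) = ρ x (ι m)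

end Basic

end AffineAlgebraicGroup

/-! The Galois connection is formal; the content is that `H'' = H` is equivalent to observability.

Observable implies `H'' = H` (`IsObservable.stab_fixedSubalgebra`). Let `W` be a finite dimensional
`H`-stable space of equations of `H`, with basis `wᵢ`, and embed its dual in a `G`-module by `ι`.
The canonical element of `W ⊗ W*` is `H`-invariant, so every coordinate of `y ↦ ∑ wᵢ(y) y·ι(eᵢ)`
lies in `H'`. These coordinates vanish at `1`, hence at each `x ∈ H''`; as `x` and `ι` are
injective, all `wᵢ(x)` are zero and `x ∈ H`.

Conversely, suppose `H'' = H`. The crux is `exists_inverse_semiinvariant`: a semi-invariant `f` with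
`f(1) ≠ 0` has a nonzero multiple in `H'`, so the inverse of its weight also occurs. Otherwise the
generic fibre of `Spec k[G] → Spec H'` has a point where `f = 0`, to be compared with the generic
point of `G`. But two points with the same invariants differ by an element of `H'' = H`, which only
scales `f`. Determinants then give equivariant maps killing any finite dimensional `H`-submodule of
`k[G]` (`exists_equivariant_map_ne_zero`). They repair the lifts to `k[G]` of matrix coefficients of
a rational `H`-module, which are equivariant only modulo functions vanishing on `H`. Finitely many
of the resulting maps embed the module in a power of a `G`-stable space. Connectedness enters by
making `k[G]` a domain. -/

/-- A homogeneous connected noetherian space is irreducible. -/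
theorem preirreducibleSpace_of_homogeneous {X : Type*} [TopologicalSpace X]
    [TopologicalSpace.NoetherianSpace X] [ConnectedSpace X]
    (h : ∀ x y : X, ∃ e : X ≃ₜ X, e x = y) : PreirreducibleSpace X := by
  have hfin := TopologicalSpace.NoetherianSpace.finite_irreducibleComponents (α := X)
  obtain ⟨x₀⟩ : Nonempty X := inferInstance
  set C := irreducibleComponent x₀
  have hC : C ∈ irreducibleComponents X := irreducibleComponent_mem_irreducibleComponents x₀
  -- Otherwise the finitely many other components cover the irreducible `C`, so one of them contains
  -- it, against maximality.
  obtain ⟨x, hxC, hx⟩ : ∃ x ∈ C, ∀ D ∈ irreducibleComponents X, x ∈ D → D = C := by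
    by_contra! hcon
    have hcov : C ⊆ ⋃₀ ((hfin.subset (Set.sdiff_subset (t := {C}))).toFinset : Set (Set X)) := by
      intro x hx
      obtain ⟨D, hD, hxD, hne⟩ := hcon x hx
      exact ⟨D, by simpa using ⟨hD, hne⟩, hxD⟩
    obtain ⟨D, hD, hCD⟩ := isIrreducible_iff_sUnion_isClosed.1 hC.1 _ (by
      intro D hD
      simp only [Set.Finite.mem_toFinset, Set.mem_sdiff] at hD
      exact isClosed_of_mem_irreducibleComponents D hD.1) hcov
    simp only [Set.Finite.mem_toFinset, Set.mem_sdiff, Set.mem_singleton_iff] at hD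
    exact hD.2 (hC.eq_of_ge hD.1.1 hCD)
  have huniq : ∀ y, ∀ D ∈ irreducibleComponents X, ∀ E ∈ irreducibleComponents X,
      y ∈ D → y ∈ E → D = E := by
    intro y D hD E hE hyD hyE
    obtain ⟨e, he⟩ := h x y
    have key : ∀ D ∈ irreducibleComponents X, y ∈ D → e ⁻¹' D = C := fun D hD hy =>
      hx _ (preimage_mem_irreducibleComponents hD e.isOpenEmbedding
        ⟨y, hy, e.surjective y⟩) (by simpa [he] using hy)
    exact e.surjective.preimage_injective ((key D hD hyD).trans (key E hE hyE).symm)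
  -- By homogeneity the components are pairwise disjoint, so the complement of `C` is a finite union
  -- of closed sets.
  have hclopen : IsClopen C := by
    refine ⟨isClosed_irreducibleComponent, ?_⟩
    have : Cᶜ = ⋃₀ (irreducibleComponents X \ {C}) := by
      ext y
      constructor
      · intro hy
        exact ⟨irreducibleComponent y, ⟨irreducibleComponent_mem_irreducibleComponents y,
          fun he => hy (he ▸ mem_irreducibleComponent)⟩, mem_irreducibleComponent⟩
      · rintro ⟨D, ⟨hD, hne⟩, hyD⟩ hyC
        exact hne (huniq y D hD C hC hyD hyC)
    rw [← isClosed_compl_iff, this]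
    rw [Set.sUnion_eq_biUnion]
    exact (hfin.subset Set.sdiff_subset).isClosed_biUnion fun D hD =>
      isClosed_of_mem_irreducibleComponents D hD.1
  have := hclopen.eq_univ ⟨x, hxC⟩
  exact ⟨this ▸ hC.1.2⟩

/-! ### Translations, the Zariski topology, and integrality of `k[G]` -/

namespace AffineAlgebraicGroup

variable {k : Type u} {G : Type v} [Field k] [Group G] (𝔾 : AffineAlgebraicGroup k G)

instance : Algebra.FiniteType k 𝔾.coordRing :=
  (Subalgebra.fg_iff_finiteType _).1 𝔾.fg

instance : IsNoetherianRing 𝔾.coordRing := Algebra.FiniteType.isNoetherianRing k _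

instance : Nontrivial 𝔾.coordRing :=
  ⟨0, 1, fun h => zero_ne_one (congrFun (congrArg Subtype.val h) (1 : G))⟩

/-- Evaluation at a point of `G`. -/
def evalHom (x : G) : 𝔾.coordRing →ₐ[k] k :=
  (Pi.evalAlgHom k (fun _ : G => k) x).comp 𝔾.coordRing.val

@[simp]
theorem evalHom_apply (x : G) (f : 𝔾.coordRing) : 𝔾.evalHom x f = (f : G → k) x := rfl

/-- The algebra homomorphism `f ↦ (y ↦ f (x y))` of `k[G]`. -/
def leftTranslate (x : G) : 𝔾.coordRing →ₐ[k] 𝔾.coordRing where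
  toFun f := ⟨fun y => (f : G → k) (x * y), 𝔾.comp_mul_left_mem x f⟩
  map_one' := rfl
  map_mul' _ _ := rfl
  map_zero' := rfl
  map_add' _ _ := rfl
  commutes' _ := rfl

@[simp]
theorem leftTranslate_apply (x y : G) (f : 𝔾.coordRing) :
    (𝔾.leftTranslate x f : G → k) y = (f : G → k) (x * y) := rfl

theorem translate_leftTranslate (x y : G) (f : 𝔾.coordRing) :
    𝔾.translate x (𝔾.leftTranslate y f) = 𝔾.leftTranslate y (𝔾.translate x f) := by
  ext z
  simp [mul_assoc]

theorem translate_translate (x y : G) (f : 𝔾.coordRing) :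
    𝔾.translate x (𝔾.translate y f) = 𝔾.translate (x * y) f := by
  ext z
  simp [mul_assoc]

theorem translate_one (f : 𝔾.coordRing) : 𝔾.translate 1 f = f := by
  ext z
  simp

theorem zeroLocus_antitone {S T : Set 𝔾.coordRing} (h : S ⊆ T) :
    𝔾.zeroLocus T ⊆ 𝔾.zeroLocus S := fun _ hx f hf => hx f (h hf)

theorem zeroLocus_span (S : Set 𝔾.coordRing) :
    𝔾.zeroLocus (Ideal.span S : Set 𝔾.coordRing) = 𝔾.zeroLocus S := by
  refine (𝔾.zeroLocus_antitone Ideal.subset_span).antisymm fun x hx f hf => ?_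
  have : Ideal.span S ≤ RingHom.ker (𝔾.evalHom x) := Ideal.span_le.2 fun g hg => hx g hg
  exact this hf

theorem exists_finset_zeroLocus_eq (S : Set 𝔾.coordRing) :
    ∃ T : Finset 𝔾.coordRing, 𝔾.zeroLocus (T : Set 𝔾.coordRing) = 𝔾.zeroLocus S := by
  obtain ⟨T, hT⟩ := IsNoetherian.noetherian (Ideal.span S)
  refine ⟨T, ?_⟩
  rw [← zeroLocus_span, ← zeroLocus_span _ S]
  exact congrArg (fun I : Ideal 𝔾.coordRing => 𝔾.zeroLocus (I : Set 𝔾.coordRing)) hT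

/-- Passing to vanishing ideals turns descending chains of closed sets into ascending chains in the
noetherian ring `k[G]`. -/
theorem noetherianSpace : @TopologicalSpace.NoetherianSpace G 𝔾.zariskiTopology := by
  let _ := 𝔾.zariskiTopology
  refine ((TopologicalSpace.noetherianSpace_TFAE G).out 0 1).2 ?_
  let I : TopologicalSpace.Closeds G → Ideal 𝔾.coordRing := fun Z =>
    { carrier := {f | ∀ x ∈ Z, (f : G → k) x = 0}
      add_mem' := fun hf hg x hx => by simp [hf x hx, hg x hx]
      zero_mem' := fun x _ => rfl
      smul_mem' := fun c f hf x hx => by simp [hf x hx] }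
  have hI : ∀ Z W : TopologicalSpace.Closeds G, I Z ≤ I W → W ≤ Z := by
    intro Z W hle x hx
    obtain ⟨S, hS⟩ := (𝔾.isClosed_iff (Z : Set G)).1 Z.isClosed
    change x ∈ (Z : Set G)
    rw [hS]
    intro f hf
    refine hle (fun y hy => ?_) x hx
    have hy' : y ∈ (Z : Set G) := hy
    rw [hS] at hy'
    exact hy' f hf
  refine ⟨?_⟩
  have hwf : WellFounded (fun I J : Ideal 𝔾.coordRing => I > J) := wellFounded_gt
  refine Subrelation.wf (r := InvImage (fun I J : Ideal 𝔾.coordRing => I > J) I) ?_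
    (InvImage.wf I hwf)
  intro Z W hZW
  exact lt_of_le_not_ge (fun f hf x hx => hf x (hZW.le hx)) fun h => hZW.not_ge (hI _ _ h)

theorem continuous_mul_right (x : G) :
    @Continuous G G 𝔾.zariskiTopology 𝔾.zariskiTopology (fun y => y * x) := by
  let _ := 𝔾.zariskiTopology
  refine continuous_iff_isClosed.2 fun Z hZ => ?_
  obtain ⟨S, rfl⟩ := (𝔾.isClosed_iff Z).1 hZ
  refine (𝔾.isClosed_iff _).2 ⟨𝔾.translate x '' S, ?_⟩
  ext y
  exact (Set.forall_mem_image (f := 𝔾.translate x) (p := fun f => (f : G → k) y = 0)).symm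

theorem isDomain_coordRing (hG : 𝔾.IsConnected) : IsDomain 𝔾.coordRing := by
  let _ := 𝔾.zariskiTopology
  have : ConnectedSpace G := hG
  have := 𝔾.noetherianSpace
  have hirr : PreirreducibleSpace G := preirreducibleSpace_of_homogeneous fun x y =>
    ⟨{ toFun := fun z => z * (x⁻¹ * y)
       invFun := fun z => z * (x⁻¹ * y)⁻¹
       left_inv := fun z => by simp [mul_assoc]
       right_inv := fun z => by simp [mul_assoc]
       continuous_toFun := 𝔾.continuous_mul_right _
       continuous_invFun := 𝔾.continuous_mul_right _ }, by simp⟩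
  have hnz : NoZeroDivisors 𝔾.coordRing := by
    refine ⟨fun {f g} hfg => ?_⟩
    have hcl : ∀ f : 𝔾.coordRing, IsClosed (𝔾.zeroLocus {f}) := fun f =>
      (𝔾.isClosed_iff _).2 ⟨_, rfl⟩
    have hcov : (Set.univ : Set G) ⊆ 𝔾.zeroLocus {f} ∪ 𝔾.zeroLocus {g} := by
      intro x _
      have := congrFun (congrArg Subtype.val hfg) x
      simpa [zeroLocus] using this
    have hz : ∀ f : 𝔾.coordRing, Set.univ ⊆ 𝔾.zeroLocus {f} → f = 0 := fun f hf => by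
      ext x
      exact hf (Set.mem_univ x) f rfl
    exact (isPreirreducible_iff_isClosed_union_isClosed.1 hirr.isPreirreducible_univ _ _
      (hcl f) (hcl g) hcov).imp (hz f) (hz g)
  exact NoZeroDivisors.to_isDomain _

end AffineAlgebraicGroup

/-! ### Linear independence and determinants of values -/

/-- Linearly independent functions are separated by the determinant of their values at suitable
points. -/
theorem exists_det_apply_ne_zero {k α ι : Type*} [Field k] [Fintype ι] [DecidableEq ι]
    (w : ι → α → k) (hw : LinearIndependent k w) :
    ∃ a : ι → α, (Matrix.of fun i j => w i (a j)).det ≠ 0 := by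
  classical
  let c : α → ι → k := fun x i => w i x
  have hspan : Submodule.span k (Set.range c) = ⊤ := by
    by_contra hne
    obtain ⟨φ, hφ, hle⟩ := Submodule.exists_le_ker_of_lt_top _ (lt_top_iff_ne_top.2 hne)
    -- A functional killing every vector of values `c x` is a linear relation between the `w i`.
    have hsum : ∀ v, φ v = ∑ i, φ (Pi.single i 1) * v i := fun v => by
      conv_lhs => rw [← (Pi.basisFun k ι).sum_repr v]
      simp [mul_comm]
    have hzero := Fintype.linearIndependent_iff.1 hw (fun i => φ (Pi.single i 1)) (by
      ext x
      have hx : φ (c x) = 0 := hle (Submodule.subset_span ⟨x, rfl⟩)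
      rw [hsum] at hx
      simpa [c] using hx)
    refine hφ (LinearMap.ext fun v => ?_)
    rw [hsum]
    simp [hzero]
  obtain ⟨b, hb, hbspan, hbli⟩ := exists_linearIndependent k (Set.range c)
  let B : Module.Basis b k (ι → k) := Module.Basis.mk hbli (by simp [hbspan, hspan])
  let e : ι ≃ b := (Pi.basisFun k ι).indexEquiv B
  choose p hp using fun x : b => hb x.2
  refine ⟨fun i => p (e i), ?_⟩
  rw [← isUnit_iff_ne_zero, ← Matrix.isUnit_iff_isUnit_det,
    ← Matrix.linearIndependent_cols_iff_isUnit]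
  have : (Matrix.of fun i j => w i (p (e j))).col = fun j => ((e j : b) : ι → k) := by
    ext j i
    exact congrFun (hp (e j)) i
  rw [this]
  exact hbli.comp e e.injective

theorem LinearIndependent.matrix_ext {k V m ι : Type*} [Field k] [AddCommGroup V] [Module k V]
    [Fintype ι] {w : ι → V} (hw : LinearIndependent k w) {M N : Matrix m ι k}
    (h : ∀ i, ∑ j, M i j • w j = ∑ j, N i j • w j) : M = N := by
  ext i j
  have := Fintype.linearIndependent_iff.1 hw (fun j => M i j - N i j)
    (by simp [sub_smul, Finset.sum_sub_distrib, h i]) j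
  exact sub_eq_zero.1 this

/-! ### Finite dimensional stable spaces of functions and their determinants -/

namespace AffineAlgebraicGroup

variable {k : Type u} {G : Type v} [Field k] [Group G] (𝔾 : AffineAlgebraicGroup k G)

theorem linearIndependent_val {ι : Type*} {w : ι → 𝔾.coordRing} (hw : LinearIndependent k w) :
    LinearIndependent k (fun i => (w i : G → k)) :=
  hw.map' 𝔾.coordRing.val.toLinearMap (LinearMap.ker_eq_bot.2 Subtype.val_injective)

theorem coe_sum {ι : Type*} (s : Finset ι) (f : ι → 𝔾.coordRing) (x : G) :
    ((∑ i ∈ s, f i : 𝔾.coordRing) : G → k) x = ∑ i ∈ s, (f i : G → k) x :=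
  map_sum (𝔾.evalHom x) f s

/-- The span of the translates of the elements of a set. -/
def translateSpan (S : Set 𝔾.coordRing) : Submodule k 𝔾.coordRing :=
  Submodule.span k {f | ∃ x : G, ∃ s ∈ S, f = 𝔾.translate x s}

theorem subset_translateSpan (S : Set 𝔾.coordRing) : S ⊆ 𝔾.translateSpan S := fun s hs =>
  Submodule.subset_span ⟨1, s, hs, (𝔾.translate_one s).symm⟩

theorem translate_mem_translateSpan (S : Set 𝔾.coordRing) (x : G) {f : 𝔾.coordRing}
    (hf : f ∈ 𝔾.translateSpan S) : 𝔾.translate x f ∈ 𝔾.translateSpan S := by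
  have : 𝔾.translateSpan S ≤ (𝔾.translateSpan S).comap (𝔾.translate x).toLinearMap := by
    refine Submodule.span_le.2 ?_
    rintro _ ⟨y, s, hs, rfl⟩
    exact Submodule.subset_span ⟨x * y, s, hs, 𝔾.translate_translate x y s⟩
  exact this hf

/-- All translates of `s` are combinations of the finitely many left factors in the formula for `s
(y * x)`. -/
theorem finiteDimensional_translateSpan {S : Set 𝔾.coordRing} (hS : S.Finite) :
    FiniteDimensional k (𝔾.translateSpan S) := by
  choose n f₁ f₂ h using fun f : 𝔾.coordRing => 𝔾.mul_mem f f.2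
  have hfin : (⋃ s ∈ S, Set.range (f₁ s)).Finite := hS.biUnion fun s _ => Set.finite_range _
  have := FiniteDimensional.span_of_finite k hfin
  refine Submodule.finiteDimensional_of_le (S₂ := Submodule.span k (⋃ s ∈ S, Set.range (f₁ s))) ?_
  refine Submodule.span_le.2 ?_
  rintro _ ⟨x, s, hs, rfl⟩
  have : 𝔾.translate x s = ∑ i, (f₂ s i : G → k) x • f₁ s i := by
    ext y
    simp [h, coe_sum, mul_comm]
  rw [this]
  exact Submodule.sum_mem _ fun i _ => Submodule.smul_mem _ _ <| Submodule.subset_span <|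
    Set.mem_biUnion hs ⟨i, rfl⟩

/-- The action of a subgroup on an invariant finite dimensional space of polynomial functions is
given by a matrix of polynomial functions. -/
theorem exists_matrix_translate {ι : Type*} [Fintype ι] {w : ι → 𝔾.coordRing}
    (hw : LinearIndependent k w) {S : Subgroup G}
    (hS : ∀ x ∈ S, ∀ i, 𝔾.translate x (w i) ∈ Submodule.span k (Set.range w)) :
    ∃ A : G → Matrix ι ι k, (∀ i j, (fun x => A x i j) ∈ 𝔾.coordRing) ∧
      ∀ x ∈ S, ∀ i, 𝔾.translate x (w i) = ∑ j, A x i j • w j := by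
  classical
  obtain ⟨a, ha⟩ := exists_det_apply_ne_zero _ (𝔾.linearIndependent_val hw)
  set B : Matrix ι ι k := Matrix.of fun i j => (w i : G → k) (a j)
  -- Evaluating at the points `a l` solves for the matrix by Cramer. The formula is polynomial on
  -- all of `G`, but describes the action only on `S`.
  refine ⟨fun x => (Matrix.of fun i l => (w i : G → k) (a l * x)) * B⁻¹, fun i j => ?_,
    fun x hx i => ?_⟩
  · have : (fun x => ((Matrix.of fun i l => (w i : G → k) (a l * x)) * B⁻¹ : Matrix ι ι k) i j) =
        ((∑ l, B⁻¹ l j • 𝔾.leftTranslate (a l) (w i) : 𝔾.coordRing) : G → k) := by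
      ext x
      simp [coe_sum, Matrix.mul_apply, mul_comm]
    rw [this]
    exact Subtype.property _
  · choose! c hc using fun x hx i => (Submodule.mem_span_range_iff_exists_fun k).1 (hS x hx i)
    have hM : (Matrix.of fun i l => (w i : G → k) (a l * x)) = Matrix.of (c x) * B := by
      ext i l
      have := congrFun (congrArg Subtype.val (hc x hx i)) (a l)
      rw [coe_sum] at this
      simpa [Matrix.mul_apply, B] using this.symm
    have : ((Matrix.of fun i l => (w i : G → k) (a l * x)) * B⁻¹ : Matrix ι ι k) =
        Matrix.of (c x) := by
      rw [hM, Matrix.mul_nonsing_inv_cancel_right _ _ (isUnit_iff_ne_zero.2 ha)]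
    simp only [this, Matrix.of_apply]
    exact (hc x hx i).symm

section MatrixAction

variable {ι : Type*} [Fintype ι] {w : ι → 𝔾.coordRing} {S : Subgroup G} {A : G → Matrix ι ι k}

theorem matrix_translate_one [DecidableEq ι] (hw : LinearIndependent k w)
    (hA : ∀ x ∈ S, ∀ i, 𝔾.translate x (w i) = ∑ j, A x i j • w j) : A 1 = 1 :=
  hw.matrix_ext fun i => by
    rw [← hA 1 S.one_mem, translate_one]
    simp [Matrix.one_apply]

/-- The factors are reversed because row `i` holds the coordinates of the translate of `w i`; hence
the right multiplication in `matrixRep` and the inverse in `contragredient`. -/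
theorem matrix_translate_mul (hw : LinearIndependent k w)
    (hA : ∀ x ∈ S, ∀ i, 𝔾.translate x (w i) = ∑ j, A x i j • w j) {x y : G} (hx : x ∈ S)
    (hy : y ∈ S) : A (x * y) = A y * A x :=
  hw.matrix_ext fun i => by
    rw [← hA _ (S.mul_mem hx hy), ← translate_translate, hA y hy, map_sum]
    simp_rw [map_smul, hA x hx, Matrix.mul_apply, Finset.sum_smul, Finset.smul_sum, smul_smul]
    exact Finset.sum_comm

/-- The function `y ↦ det (wᵢ (aⱼ y))`. -/
def detFun [DecidableEq ι] (w : ι → 𝔾.coordRing) (a : ι → G) : 𝔾.coordRing :=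
  (Matrix.of fun i j => 𝔾.leftTranslate (a j) (w i)).det

theorem detFun_apply [DecidableEq ι] (w : ι → 𝔾.coordRing) (a : ι → G) (x : G) :
    (𝔾.detFun w a : G → k) x = (Matrix.of fun i j => (w i : G → k) (a j * x)).det := by
  rw [← evalHom_apply, detFun, AlgHom.map_det]
  rfl

theorem translate_detFun [DecidableEq ι] {x : G} {M : Matrix ι ι k}
    (hM : ∀ i, 𝔾.translate x (w i) = ∑ j, M i j • w j) (a : ι → G) :
    𝔾.translate x (𝔾.detFun w a) = M.det • 𝔾.detFun w a := by
  ext y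
  have : (Matrix.of fun i j => (w i : G → k) (a j * (y * x))) =
      M * Matrix.of fun i j => (w i : G → k) (a j * y) := by
    ext i j
    have := congrFun (congrArg Subtype.val (hM i)) (a j * y)
    rw [coe_sum] at this
    simpa [Matrix.mul_apply, mul_assoc] using this
  rw [translate_apply, detFun_apply, this, Matrix.det_mul]
  simp [detFun_apply]

end MatrixAction

/-- The linear map `u ↦ det (u (aⱼ y); wᵢ (aⱼ y))`. -/
def detConsMap {d : ℕ} (w : Fin d → 𝔾.coordRing) (a : Fin (d + 1) → G) :
    𝔾.coordRing →ₗ[k] 𝔾.coordRing :=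
  ∑ j : Fin (d + 1), (LinearMap.mulLeft k ((-1) ^ (j : ℕ) * 𝔾.detFun w (a ∘ j.succAbove))).comp
    (𝔾.leftTranslate (a j)).toLinearMap

theorem detConsMap_apply {d : ℕ} (w : Fin d → 𝔾.coordRing) (a : Fin (d + 1) → G)
    (u : 𝔾.coordRing) : 𝔾.detConsMap w a u = 𝔾.detFun (Fin.cons u w : Fin (d + 1) → _) a := by
  rw [detFun, Matrix.det_succ_row_zero, detConsMap, LinearMap.sum_apply]
  refine Finset.sum_congr rfl fun j _ => ?_
  simp only [LinearMap.comp_apply, LinearMap.mulLeft_apply, AlgHom.toLinearMap_apply,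
    Matrix.of_apply, Fin.cons_zero]
  rw [mul_right_comm]
  rfl

theorem detConsMap_eq_zero {d : ℕ} (w : Fin d → 𝔾.coordRing) (a : Fin (d + 1) → G)
    {u : 𝔾.coordRing} (hu : u ∈ Submodule.span k (Set.range w)) : 𝔾.detConsMap w a u = 0 := by
  have : Submodule.span k (Set.range w) ≤ LinearMap.ker (𝔾.detConsMap w a) := by
    refine Submodule.span_le.2 ?_
    rintro _ ⟨i, rfl⟩
    rw [SetLike.mem_coe, LinearMap.mem_ker, detConsMap_apply]
    exact Matrix.det_zero_of_row_eq (Fin.succ_ne_zero i).symm (by ext; simp)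
  exact this hu

/-- Each minor in the expansion along the row of `u` involves only the `w i`, so translation
multiplies it by `M.det`; `u` itself need not lie in a stable space. -/
theorem detConsMap_translate {d : ℕ} {w : Fin d → 𝔾.coordRing} {x : G}
    {M : Matrix (Fin d) (Fin d) k} (hM : ∀ i, 𝔾.translate x (w i) = ∑ j, M i j • w j)
    (a : Fin (d + 1) → G) (u : 𝔾.coordRing) :
    𝔾.translate x (𝔾.detConsMap w a u) = M.det • 𝔾.detConsMap w a (𝔾.translate x u) := by
  simp only [detConsMap, LinearMap.sum_apply, LinearMap.comp_apply, LinearMap.mulLeft_apply,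
    AlgHom.toLinearMap_apply, map_sum, map_mul, map_pow, map_neg, map_one,
    𝔾.translate_detFun hM, translate_leftTranslate, Finset.smul_sum, mul_smul_comm, smul_mul_assoc]

end AffineAlgebraicGroup

/-! ### Commutative algebra: geometric points of fibres and the Nullstellensatz -/

open TensorProduct in
/-- Two field extensions of the fraction field of a domain have a common extension. -/
theorem exists_field_amalgam {R : Type u} {L₁ : Type v} {L₂ : Type w} [CommRing R] [IsDomain R]
    [Field L₁] [Field L₂] (i₁ : R →+* L₁) (i₂ : R →+* L₂) (h₁ : Function.Injective i₁)
    (h₂ : Function.Injective i₂) :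
    ∃ (Ω : Type (max v w)) (_ : Field Ω) (j₁ : L₁ →+* Ω) (j₂ : L₂ →+* Ω),
      j₁.comp i₁ = j₂.comp i₂ := by
  let e₁ : FractionRing R →+* L₁ := IsFractionRing.lift h₁
  let e₂ : FractionRing R →+* L₂ := IsFractionRing.lift h₂
  let _ := e₁.toAlgebra
  let _ := e₂.toAlgebra
  let T := L₁ ⊗[FractionRing R] L₂
  -- A tensor product of two nonzero vector spaces over a field is nonzero, so `T` has a residue
  -- field.
  obtain ⟨m, hm⟩ := Ideal.exists_maximal T
  let q := Ideal.Quotient.mk m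
  refine ⟨T ⧸ m, Ideal.Quotient.field m,
    q.comp (Algebra.TensorProduct.includeLeft : L₁ →ₐ[FractionRing R] T).toRingHom,
    q.comp (Algebra.TensorProduct.includeRight : L₂ →ₐ[FractionRing R] T).toRingHom, ?_⟩
  ext r
  have hr₁ : i₁ r = algebraMap (FractionRing R) L₁ (algebraMap R _ r) :=
    (IsFractionRing.lift_algebraMap h₁ r).symm
  have hr₂ : i₂ r = algebraMap (FractionRing R) L₂ (algebraMap R _ r) :=
    (IsFractionRing.lift_algebraMap h₂ r).symm
  simp only [RingHom.comp_apply, hr₁, hr₂, AlgHom.toRingHom_eq_coe, RingHom.coe_coe,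
    AlgHom.commutes]

/-- If no nonzero multiple of `f` lies in `R`, then the generic fibre of `R → A` has a geometric
point at which `f` vanishes, over a field which also contains `A`. -/
theorem exists_ringHom_field_map_eq_zero {R : Type u} {A : Type v} [CommRing R] [CommRing A]
    [IsDomain A] [Algebra R A] (hinj : Function.Injective (algebraMap R A)) (f : A)
    (hf : ∀ r : R, f ∣ algebraMap R A r → r = 0) :
    ∃ (Ω : Type v) (_ : Field Ω) (a b : A →+* Ω),
      (∀ r : R, a (algebraMap R A r) = b (algebraMap R A r)) ∧ a f = 0 ∧ Function.Injective b := by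
  have : IsDomain R := hinj.isDomain
  -- Since `q` avoids the nonzero elements of `R`, both the residue field of `q` and the fraction
  -- field of `A` extend that of `R`; they yield `a` and `b`.
  obtain ⟨q, hq, hfq, hqS⟩ := Ideal.exists_le_prime_disjoint (Ideal.span {f})
    ((nonZeroDivisors R).map (algebraMap R A)) (by
      rw [Set.disjoint_left]
      rintro _ hr ⟨r, hrR, rfl⟩
      exact nonZeroDivisors.ne_zero hrR (hf r (Ideal.mem_span_singleton.1 hr)))
  let a₀ : A →+* FractionRing (A ⧸ q) :=
    (algebraMap (A ⧸ q) (FractionRing (A ⧸ q))).comp (Ideal.Quotient.mk q)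
  let b₀ : A →+* FractionRing A := algebraMap _ _
  have ha₀ : ∀ r, a₀ r = 0 ↔ r ∈ q := fun r => by
    rw [← Ideal.Quotient.eq_zero_iff_mem]
    exact (IsFractionRing.injective (A ⧸ q) _).eq_iff' (map_zero _)
  have hb₀ : Function.Injective b₀ := IsFractionRing.injective A _
  obtain ⟨Ω, hΩ, j₁, j₂, hj⟩ := exists_field_amalgam (a₀.comp (algebraMap R A))
    (b₀.comp (algebraMap R A))
    ((injective_iff_map_eq_zero _).2 fun r hr => by
      by_contra hr₀
      exact Set.disjoint_left.1 hqS ((ha₀ _).1 hr)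
        ⟨r, mem_nonZeroDivisors_of_ne_zero hr₀, rfl⟩)
    (hb₀.comp hinj)
  refine ⟨Ω, hΩ, j₁.comp a₀, j₂.comp b₀, DFunLike.congr_fun hj, ?_, j₂.injective.comp hb₀⟩
  rw [RingHom.comp_apply, (ha₀ f).2 (hfq (Ideal.mem_span_singleton_self f)), map_zero]

/-- The Nullstellensatz: every maximal ideal of a finitely generated algebra over an algebraically
closed field is the kernel of a point. -/
theorem Ideal.IsMaximal.exists_algHom_ker_eq {k T : Type*} [Field k] [IsAlgClosed k] [CommRing T]
    [Algebra k T] [Algebra.FiniteType k T] {m : Ideal T} (hm : m.IsMaximal) :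
    ∃ φ : T →ₐ[k] k, ∀ t, φ t = 0 ↔ t ∈ m := by
  let _ := Ideal.Quotient.field m
  have : Algebra.FiniteType k (T ⧸ m) :=
    Algebra.FiniteType.of_surjective (Ideal.Quotient.mkₐ k m) Ideal.Quotient.mk_surjective
  have := finite_of_finite_type_of_isJacobsonRing k (T ⧸ m)
  let e : k ≃ₐ[k] (T ⧸ m) := AlgEquiv.ofBijective (Algebra.ofId k _)
    IsAlgClosed.algebraMap_bijective_of_isIntegral
  refine ⟨(e.symm : (T ⧸ m) →ₐ[k] k).comp (Ideal.Quotient.mkₐ k m), fun t => ?_⟩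
  simp [Ideal.Quotient.eq_zero_iff_mem]

/-! ### Inverting the weights of semi-invariants -/

namespace AffineAlgebraicGroup

open TensorProduct

variable {k : Type u} {G : Type v} [Field k] [Group G] (𝔾 : AffineAlgebraicGroup k G)

theorem leftTranslate_mem_fixedSubalgebra {H : 𝔾.ClosedSubgroup} (x : G) {r : 𝔾.coordRing}
    (hr : r ∈ 𝔾.fixedSubalgebra H) : 𝔾.leftTranslate x r ∈ 𝔾.fixedSubalgebra H := fun h hh => by
  rw [translate_leftTranslate, hr h hh]

/-- If no invariant separates `x` from `y`, then `x⁻¹ y` fixes all invariants. -/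
theorem inv_mul_mem_stab {H : 𝔾.ClosedSubgroup} {x y : G}
    (h : ∀ r ∈ 𝔾.fixedSubalgebra H, (r : G → k) x = (r : G → k) y) :
    x⁻¹ * y ∈ (𝔾.stab (𝔾.fixedSubalgebra H)).1 := by
  intro r hr
  ext z
  have := h _ (𝔾.leftTranslate_mem_fixedSubalgebra (z * x⁻¹) hr)
  simpa [mul_assoc] using this.symm

/-- A prime ideal of `k[G] ⊗ k[G]` which contains the ideal generated by the `r ⊗ 1 - 1 ⊗ r`,
for `r` invariant, contains every function vanishing at the points `(x, x h)`, `h ∈ H''`. -/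
theorem mem_prime_of_vanish [IsAlgClosed k] {H : 𝔾.ClosedSubgroup}
    {P : Ideal (𝔾.coordRing ⊗[k] 𝔾.coordRing)} (hP : P.IsPrime)
    (hPR : ∀ r ∈ 𝔾.fixedSubalgebra H, r ⊗ₜ 1 - 1 ⊗ₜ r ∈ P)
    {t : 𝔾.coordRing ⊗[k] 𝔾.coordRing}
    (ht : ∀ x, ∀ h ∈ (𝔾.stab (𝔾.fixedSubalgebra H)).1,
      Algebra.TensorProduct.lift (𝔾.evalHom x) (𝔾.evalHom (x * h)) (fun _ _ => Commute.all _ _) t = 0) : t ∈ P := by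
  have : Algebra.FiniteType k (𝔾.coordRing ⊗[k] 𝔾.coordRing) :=
    Algebra.FiniteType.trans (S := 𝔾.coordRing) inferInstance inferInstance
  have : IsJacobsonRing (𝔾.coordRing ⊗[k] 𝔾.coordRing) := isJacobsonRing_of_finiteType (A := k)
  -- `P` is an intersection of maximal ideals. Each is a pair `(x, y)` at which all invariants
  -- agree, that is `y = x h` with `h = x⁻¹ y` in `H''`.
  rw [← IsJacobsonRing.out this hP.isRadical, Ideal.jacobson, Ideal.mem_sInf]
  rintro m ⟨hPm, hm⟩
  obtain ⟨φ, hφ⟩ := hm.exists_algHom_ker_eq (k := k)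
  obtain ⟨x, hx⟩ := 𝔾.bijective_eval.2 (φ.comp Algebra.TensorProduct.includeLeft)
  obtain ⟨y, hy⟩ := 𝔾.bijective_eval.2 (φ.comp Algebra.TensorProduct.includeRight)
  have hx' : ∀ f : 𝔾.coordRing, φ (f ⊗ₜ 1) = (f : G → k) x := fun f =>
    (DFunLike.congr_fun hx f).symm
  have hy' : ∀ f : 𝔾.coordRing, φ (1 ⊗ₜ f) = (f : G → k) y := fun f =>
    (DFunLike.congr_fun hy f).symm
  have hxy := 𝔾.inv_mul_mem_stab (H := H) (x := x) (y := y) fun r hr => by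
    rw [← hx', ← hy', ← sub_eq_zero, ← map_sub, hφ]
    exact hPm (hPR r hr)
  have heq : φ = Algebra.TensorProduct.lift (𝔾.evalHom x) (𝔾.evalHom (x * (x⁻¹ * y)))
      (fun _ _ => Commute.all _ _) := by
    ext f
    · simp [hx']
    · simp [hy']
  rw [← hφ, heq]
  exact ht x _ hxy

set_option synthInstance.maxHeartbeats 200000 in
/-- If `H = H''` then the inverse of the weight of a semi-invariant is the weight of a
semi-invariant. -/
theorem exists_inverse_semiinvariant [IsAlgClosed k] [IsDomain 𝔾.coordRing] {H : 𝔾.ClosedSubgroup}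
    (hH : 𝔾.stab (𝔾.fixedSubalgebra H) = H) {f : 𝔾.coordRing} (hf₁ : (f : G → k) 1 ≠ 0)
    (hf : ∀ h ∈ H.1, ∀ y, (f : G → k) (y * h) * (f : G → k) 1 = (f : G → k) y * (f : G → k) h) :
    ∃ g : 𝔾.coordRing, g ≠ 0 ∧
      ∀ h ∈ H.1, (f : G → k) h • 𝔾.translate h g = (f : G → k) 1 • g := by
  have hf₀ : f ≠ 0 := by
    rintro rfl
    exact hf₁ rfl
  suffices ∃ g, g ≠ 0 ∧ f * g ∈ 𝔾.fixedSubalgebra H by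
    obtain ⟨g, hg, hfg⟩ := this
    refine ⟨g, hg, fun h hh => mul_left_cancel₀ hf₀ ?_⟩
    ext y
    have h1 := congrFun (congrArg Subtype.val (hfg h hh)) y
    have h2 := hf h hh y
    simp only [translate_apply, MulMemClass.coe_mul, Pi.mul_apply, SetLike.val_smul, Pi.smul_apply,
      smul_eq_mul] at h1 ⊢
    linear_combination (f : G → k) 1 * h1 - (g : G → k) (y * h) * h2
  by_contra! hcon
  let R := 𝔾.fixedSubalgebra H
  obtain ⟨Ω, _, a₀, b₀, hab, hfa, hb₀⟩ := exists_ringHom_field_map_eq_zero (R := R)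
    Subtype.val_injective f fun r ⟨g, hg⟩ => by
      by_contra hr₀
      refine hcon g ?_ (hg ▸ r.2)
      rintro rfl
      exact hr₀ (Subtype.ext (hg.trans (mul_zero f)))
  let _ : Algebra k Ω := (b₀.comp (algebraMap k 𝔾.coordRing)).toAlgebra
  -- The `k`-structure of `Ω` comes from `b₀`; `a₀` respects it because constants are invariant.
  let a : 𝔾.coordRing →ₐ[k] Ω := { a₀ with commutes' := fun c => hab (algebraMap k R c) }
  let b : 𝔾.coordRing →ₐ[k] Ω := { b₀ with commutes' := fun c => rfl }
  let Φ : 𝔾.coordRing ⊗[k] 𝔾.coordRing →ₐ[k] Ω :=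
    Algebra.TensorProduct.lift a b (fun _ _ => Commute.all _ _)
  obtain ⟨n, f₁, f₂, hmul⟩ := 𝔾.mul_mem f f.2
  let f₁' : Fin n → 𝔾.coordRing := fun i => ⟨fun x => (f₁ i : G → k) x⁻¹, 𝔾.inv_mem _ (f₁ i).2⟩
  -- On `G × G` this is `f(1) f(y) - f(x) f(x⁻¹ y)`, which vanishes for `y = x h` by `hf`. The
  -- factor `f(x)` dies under `a`, leaving `f(1) b(f) = 0`.
  let t : 𝔾.coordRing ⊗[k] 𝔾.coordRing :=
    (f : G → k) 1 • (1 ⊗ₜ f) - ∑ i, (f * f₁' i) ⊗ₜ f₂ i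
  have ht : t ∈ RingHom.ker Φ := by
    refine 𝔾.mem_prime_of_vanish (H := H) (RingHom.ker_isPrime _) (fun r hr => ?_) fun x h hh => ?_
    · rw [RingHom.mem_ker, map_sub, Algebra.TensorProduct.lift_tmul,
        Algebra.TensorProduct.lift_tmul, map_one, map_one, mul_one, one_mul, sub_eq_zero]
      exact hab ⟨r, hr⟩
    · rw [hH] at hh
      have h1 := hf h hh x
      have h2 := hmul x⁻¹ (x * h)
      rw [inv_mul_cancel_left] at h2
      simp only [t, map_sub, map_smul, map_sum, Algebra.TensorProduct.lift_tmul, map_mul, map_one,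
        one_mul, evalHom_apply, f₁', smul_eq_mul, mul_assoc, ← Finset.mul_sum]
      rw [← h2]
      linear_combination h1
  replace hfa : a f = 0 := hfa
  have hΦ : Φ t = (f : G → k) 1 • b f := by
    simp [Φ, t, hfa]
  rw [RingHom.mem_ker, hΦ, smul_eq_zero_iff_right hf₁] at ht
  exact hf₀ (hb₀ (ht.trans (map_zero b₀).symm))

end AffineAlgebraicGroup

theorem Submodule.exists_fin_linearIndependent_span_eq {k V : Type*} [Field k] [AddCommGroup V]
    [Module k V] (K : Submodule k V) [FiniteDimensional k K] :
    ∃ (d : ℕ) (w : Fin d → V), LinearIndependent k w ∧ Submodule.span k (Set.range w) = K := by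
  let β := Module.finBasis k K
  refine ⟨_, fun i => β i, β.linearIndependent.map' K.subtype K.ker_subtype, ?_⟩
  have := congrArg (Submodule.map K.subtype) β.span_eq
  rwa [Submodule.map_span, ← Set.range_comp, Submodule.map_subtype_top] at this

/-! ### Equivariant endomorphisms of `k[G]` killing a given submodule -/

namespace AffineAlgebraicGroup

variable {k : Type u} {G : Type v} [Field k] [Group G] (𝔾 : AffineAlgebraicGroup k G)

/-- The space of polynomial functions vanishing on a subset of `G`. -/
def vanishingSubmodule (Z : Set G) : Submodule k 𝔾.coordRing where
  carrier := {f | ∀ x ∈ Z, (f : G → k) x = 0}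
  add_mem' hf hg x hx := by simp [hf x hx, hg x hx]
  zero_mem' _ _ := rfl
  smul_mem' c f hf x hx := by simp [hf x hx]

theorem translate_mem_vanishingSubmodule {H : Subgroup G} {x : G} (hx : x ∈ H)
    {f : 𝔾.coordRing} (hf : f ∈ 𝔾.vanishingSubmodule H) :
    𝔾.translate x f ∈ 𝔾.vanishingSubmodule H := fun _ hy => hf _ (H.mul_mem hy hx)

/-- If `H = H''` then the quotient of `k[G]` by a finite dimensional `H`-submodule is separated by
`H`-equivariant maps to `k[G]`. -/
theorem exists_equivariant_map_ne_zero [IsAlgClosed k] [IsDomain 𝔾.coordRing]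
    {H : 𝔾.ClosedSubgroup} (hH : 𝔾.stab (𝔾.fixedSubalgebra H) = H)
    (K : Submodule k 𝔾.coordRing) [FiniteDimensional k K]
    (hK : ∀ h ∈ H.1, ∀ f ∈ K, 𝔾.translate h f ∈ K) {u : 𝔾.coordRing} (hu : u ∉ K) :
    ∃ Ψ : 𝔾.coordRing →ₗ[k] 𝔾.coordRing,
      (∀ h ∈ H.1, ∀ f, 𝔾.translate h (Ψ f) = Ψ (𝔾.translate h f)) ∧ (∀ f ∈ K, Ψ f = 0) ∧
        Ψ u ≠ 0 := by
  obtain ⟨d, w, hw, hspan⟩ := K.exists_fin_linearIndependent_span_eq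
  obtain ⟨A, -, hA⟩ := 𝔾.exists_matrix_translate hw (S := H.1) fun h hh i => by
    rw [hspan]
    exact hK h hh _ (hspan.le (Submodule.subset_span ⟨i, rfl⟩))
  -- The points `b` make `detFun w b` a semi-invariant of weight `det A`, nonzero at `1`. The points
  -- `a` exist because `u ∉ K`, and keep `detConsMap w a u` nonzero.
  obtain ⟨b, hb⟩ := exists_det_apply_ne_zero _ (𝔾.linearIndependent_val hw)
  obtain ⟨a, ha⟩ := exists_det_apply_ne_zero _ (𝔾.linearIndependent_val
    (linearIndependent_finCons.2 ⟨hw, hspan.symm ▸ hu⟩))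
  have hdet : ∀ h ∈ H.1, ∀ y, (𝔾.detFun w b : G → k) (y * h) =
      (A h).det * (𝔾.detFun w b : G → k) y := fun h hh y =>
    congrFun (congrArg Subtype.val (𝔾.translate_detFun (hA h hh) b)) y
  have hb₁ : (𝔾.detFun w b : G → k) 1 ≠ 0 := by simpa [detFun_apply] using hb
  obtain ⟨g, hg, hgH⟩ := 𝔾.exists_inverse_semiinvariant hH hb₁ fun h hh y => by
    have := hdet h hh 1
    rw [one_mul] at this
    rw [hdet h hh, this]
    ring
  -- `detConsMap w a` kills `K` and is equivariant up to `det A`; the factor `g`, of inverse weight,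
  -- corrects this.
  refine ⟨(LinearMap.mulLeft k g).comp (𝔾.detConsMap w a), fun h hh f => ?_, fun f hf => ?_, ?_⟩
  · have hg' : (A h).det • 𝔾.translate h g = g := by
      have h1 := hgH h hh
      have h2 := hdet h hh 1
      rw [one_mul] at h2
      rw [h2, mul_comm, mul_smul] at h1
      exact smul_right_injective _ hb₁ h1
    simp only [LinearMap.comp_apply, LinearMap.mulLeft_apply, map_mul,
      𝔾.detConsMap_translate (hA h hh)]
    rw [mul_smul_comm, ← smul_mul_assoc, hg']
  · simp [𝔾.detConsMap_eq_zero w a (hspan.symm ▸ hf)]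
  · refine mul_ne_zero hg fun h0 => ha ?_
    have := congrFun (congrArg Subtype.val h0) 1
    rw [detConsMap_apply, detFun_apply] at this
    simp only [mul_one] at this
    exact this

end AffineAlgebraicGroup

/-! ### Rational modules and the Galois connection -/

namespace AffineAlgebraicGroup

variable {k : Type u} {G : Type v} [Field k] [Group G] (𝔾 : AffineAlgebraicGroup k G)

variable {𝔾} in
theorem IsRational.coeff_mem {M : Type w} [AddCommGroup M] [Module k M]
    {ρ : Representation k G M} (hρ : 𝔾.IsRational ρ) (l : Module.Dual k M) (m : M) :
    (fun x => l (ρ x m)) ∈ 𝔾.coordRing := by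
  obtain ⟨n, m', f, h⟩ := hρ m
  have : (fun x => l (ρ x m)) = ((∑ i, l (m' i) • f i : 𝔾.coordRing) : G → k) := by
    ext x
    simp [h, coe_sum, mul_comm]
  rw [this]
  exact Subtype.property _

theorem isRational_of_fintype {M : Type w} [AddCommGroup M] [Module k M]
    {ρ : Representation k G M} {ι : Type*} [Fintype ι] (f : ι → 𝔾.coordRing) (m' : M → ι → M)
    (h : ∀ m x, ρ x m = ∑ i, (f i : G → k) x • m' m i) : 𝔾.IsRational ρ := by
  intro m
  let e := Fintype.equivFin ι
  refine ⟨_, fun i => m' m (e.symm i), fun i => f (e.symm i), fun x => ?_⟩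
  rw [h, ← e.symm.sum_comp]

/-- The representation by right multiplication of matrices. -/
def matrixRep {ι : Type*} [Fintype ι] [DecidableEq ι] (p : Type*) (A : G → Matrix ι ι k)
    (h₁ : A 1 = 1) (hmul : ∀ x y, A (x * y) = A y * A x) :
    Representation k G (Matrix p ι k) where
  toFun x :=
    { toFun := fun z => z * A x
      map_add' := fun _ _ => Matrix.add_mul _ _ _
      map_smul' := fun _ _ => Matrix.smul_mul _ _ _ }
  map_one' := by
    ext1 z
    simp [h₁]
  map_mul' x y := by
    ext1 z
    simp [hmul, Matrix.mul_assoc]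

theorem isRational_matrixRep {ι : Type*} [Fintype ι] [DecidableEq ι] (p : Type*)
    {A : G → Matrix ι ι k} (h₁ : A 1 = 1) (hmul : ∀ x y, A (x * y) = A y * A x)
    (hA : ∀ i j, (fun x => A x i j) ∈ 𝔾.coordRing) :
    𝔾.IsRational (matrixRep p A h₁ hmul) := by
  refine 𝔾.isRational_of_fintype (ι := ι × ι) (fun i => ⟨_, hA i.1 i.2⟩)
    (fun z i => z * Matrix.single i.1 i.2 (1 : k)) fun z x => ?_
  change z * A x = _
  conv_lhs => rw [Matrix.matrix_eq_sum_single (A x)]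
  simp_rw [Fintype.sum_prod_type, ← Matrix.mul_smul, ← Matrix.mul_sum, Matrix.smul_single,
    smul_eq_mul, mul_one]

/-- The representation contragredient to the one given by the matrices `A`. -/
def contragredient {ι : Type*} [Fintype ι] [DecidableEq ι] (S : Subgroup G)
    (A : G → Matrix ι ι k) (h₁ : A 1 = 1) (hmul : ∀ x ∈ S, ∀ y ∈ S, A (x * y) = A y * A x) :
    Representation k S (ι → k) where
  toFun x := Matrix.mulVecLin (A (x : G)⁻¹)
  map_one' := by simp [h₁]; rfl
  map_mul' x y := by
    rw [Subgroup.coe_mul, mul_inv_rev, hmul _ (S.inv_mem y.2) _ (S.inv_mem x.2),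
      Matrix.mulVecLin_mul]
    rfl

theorem le_stab_fixedSubalgebra (H : 𝔾.ClosedSubgroup) : H ≤ 𝔾.stab (𝔾.fixedSubalgebra H) :=
  fun x hx _ hr => hr x hx

theorem galoisConnection_fixedSubalgebra_stab : GaloisConnection
    (fun H : 𝔾.ClosedSubgroup => OrderDual.toDual (𝔾.fixedSubalgebra H))
    (fun R : (Subalgebra k 𝔾.coordRing)ᵒᵈ => 𝔾.stab (OrderDual.ofDual R)) :=
  fun _ _ => ⟨fun h _ hx _ hr => h hr _ hx, fun h _ hr _ hx => h hx _ hr⟩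

/-! ### Observable subgroups satisfy `H'' = H` -/

/-- An observable subgroup is the stabilizer of its invariants. -/
theorem IsObservable.stab_fixedSubalgebra {H : 𝔾.ClosedSubgroup} (hH : 𝔾.IsObservable H) :
    𝔾.stab (𝔾.fixedSubalgebra H) = H := by
  classical
  refine le_antisymm (fun x hx => ?_) (𝔾.le_stab_fixedSubalgebra H)
  obtain ⟨S, hS⟩ := (𝔾.isClosed_iff _).1 H.2
  obtain ⟨T, hT⟩ := 𝔾.exists_finset_zeroLocus_eq S
  rw [← hT] at hS
  have := 𝔾.finiteDimensional_translateSpan T.finite_toSet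
  -- An `H`-stable finite dimensional space containing the finite set `T` of equations of `H`.
  let W := 𝔾.translateSpan (T : Set 𝔾.coordRing) ⊓ 𝔾.vanishingSubmodule H.1
  have : FiniteDimensional k W := Submodule.finiteDimensional_of_le inf_le_left
  obtain ⟨d, w, hw, hspan⟩ := W.exists_fin_linearIndependent_span_eq
  have hwW : ∀ i, w i ∈ W := fun i => hspan.le (Submodule.subset_span ⟨i, rfl⟩)
  obtain ⟨A, hApoly, hA⟩ := 𝔾.exists_matrix_translate hw (S := H.1) fun h hh i => by
    rw [hspan]
    exact ⟨𝔾.translate_mem_translateSpan _ h (hwW i).1,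
      𝔾.translate_mem_vanishingSubmodule hh (hwW i).2⟩
  have hA₁ := 𝔾.matrix_translate_one hw hA
  have hAmul := fun x hx y hy => 𝔾.matrix_translate_mul hw hA (x := x) (y := y) hx hy
  let σ := contragredient H.1 A hA₁ hAmul
  have hσ : (𝔾.toAffineAlgebraicGroup H).IsRational σ := by
    refine isRational_of_fintype _ (ι := Fin d × Fin d)
      (fun i => ⟨restrict H.1 fun y => A y⁻¹ i.1 i.2, _, 𝔾.inv_mem _ (hApoly i.1 i.2), rfl⟩)
      (fun v i => Pi.single i.1 (v i.2)) fun v h => ?_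
    ext j
    change (A (h : G)⁻¹).mulVec v j = (∑ i : Fin d × Fin d,
      A (h : G)⁻¹ i.1 i.2 • (Pi.single i.1 (v i.2) : Fin d → k)) j
    simp [Fintype.sum_prod_type, Matrix.mulVec, dotProduct, Finset.sum_apply, Pi.single_apply]
  obtain ⟨N, _, _, _, ρ, ι, hρ, hι, hισ⟩ := hH _ σ hσ
  -- This is the `H`-invariance of `∑ wᵢ ⊗ eᵢ`, read off coefficientwise and pushed forward by `ι`.
  have hsum : ∀ h : H.1, ∀ j, ∑ i, A h i j • ρ h (ι (Pi.single i 1)) = ι (Pi.single j 1) := by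
    intro h j
    have : ∑ i, A h i j • σ h (Pi.single i 1) = Pi.single j 1 := by
      have hinv : σ h⁻¹ (Pi.single j 1) = ∑ i, A h i j • (Pi.single i 1 : Fin d → k) := by
        ext i
        change (A ((h⁻¹ : H.1) : G)⁻¹).mulVec (Pi.single j 1) i = _
        simp [Finset.sum_apply, Pi.single_apply]
      simp_rw [← map_smul]
      rw [← map_sum, ← hinv, ← Module.End.mul_apply, ← map_mul, mul_inv_cancel, map_one,
        Module.End.one_apply]
    rw [← this, map_sum]
    simp [hισ]
  have hzero : ∑ i, (w i : G → k) x • ρ x (ι (Pi.single i 1)) = 0 := by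
    rw [← Module.forall_dual_apply_eq_zero_iff k]
    intro l
    -- An invariant, so its value at `x ∈ H''` equals its value at `1`, which is zero because every
    -- `w i` vanishes on `H`.
    let F : 𝔾.coordRing := ∑ i, w i * ⟨_, hρ.coeff_mem l (ι (Pi.single i 1))⟩
    have hF : ∀ y, (F : G → k) y = l (∑ i, (w i : G → k) y • ρ y (ι (Pi.single i 1))) := by
      intro y
      simp [F, coe_sum]
    have hFH : F ∈ 𝔾.fixedSubalgebra H := by
      intro h hh
      ext y
      rw [translate_apply, hF, hF]
      congr 1
      have hwh : ∀ i, (w i : G → k) (y * h) = ∑ j, A h i j * (w j : G → k) y := fun i => by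
        have := congrFun (congrArg Subtype.val (hA h hh i)) y
        rw [coe_sum] at this
        exact this
      simp_rw [hwh, Finset.sum_smul]
      rw [Finset.sum_comm]
      refine Finset.sum_congr rfl fun j _ => ?_
      rw [← hsum ⟨h, hh⟩ j, map_sum, Finset.smul_sum]
      refine Finset.sum_congr rfl fun i _ => ?_
      rw [map_mul, map_smul, smul_smul, mul_comm]
      rfl
    have hx1 := congrFun (congrArg Subtype.val (hx F hFH)) 1
    rw [translate_apply, one_mul, hF, hF] at hx1
    rw [hx1]
    simp [fun i => (hwW i).2 1 H.1.one_mem]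
  have hwx : ∀ i, (w i : G → k) x = 0 := by
    have h0 : ρ x (ι fun i => (w i : G → k) x) = 0 := by
      rw [← hzero, ← Finset.univ_sum_single (fun i => (w i : G → k) x), map_sum, map_sum]
      refine Finset.sum_congr rfl fun i _ => ?_
      rw [← map_smul, ← map_smul, ← Pi.single_smul, smul_eq_mul, mul_one]
    have h1 : (ι fun i => (w i : G → k) x) = 0 := by
      have := congrArg (ρ x⁻¹) h0
      rwa [map_zero, ← Module.End.mul_apply, ← map_mul, inv_mul_cancel, map_one,
        Module.End.one_apply] at this
    exact congrFun ((map_eq_zero_iff ι hι).1 h1)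
  change x ∈ (H.1 : Set G)
  rw [hS]
  intro f hf
  have hfW : f ∈ Submodule.span k (Set.range w) := by
    rw [hspan]
    refine ⟨𝔾.subset_translateSpan _ hf, fun y hy => ?_⟩
    rw [hS] at hy
    exact hy f hf
  have : Submodule.span k (Set.range w) ≤ LinearMap.ker (𝔾.evalHom x).toLinearMap :=
    Submodule.span_le.2 (by rintro _ ⟨i, rfl⟩; exact hwx i)
  exact this hfW

/-! ### Subgroups with `H'' = H` are observable -/

/-- If `H = H''` then rational `H`-modules are separated by equivariant maps to `k[G]`. -/
theorem exists_equivariant_map_of_rational [IsAlgClosed k] [IsDomain 𝔾.coordRing]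
    {H : 𝔾.ClosedSubgroup} (hH : 𝔾.stab (𝔾.fixedSubalgebra H) = H) {M : Type w}
    [AddCommGroup M] [Module k M] [Module.Finite k M] {σ : Representation k H.1 M}
    (hσ : (𝔾.toAffineAlgebraicGroup H).IsRational σ) {m : M} (hm : m ≠ 0) :
    ∃ Φ : M →ₗ[k] 𝔾.coordRing,
      (∀ (h : H.1) (m : M), Φ (σ h m) = 𝔾.translate h (Φ m)) ∧ Φ m ≠ 0 := by
  obtain ⟨l, hl⟩ : ∃ l : Module.Dual k M, l m ≠ 0 := by
    by_contra! h
    exact hm ((Module.forall_dual_apply_eq_zero_iff k m).1 h)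
  have hlift : ∀ m, ∃ F : 𝔾.coordRing, ∀ h : H.1, (F : G → k) h = l (σ h m) := fun m => by
    obtain ⟨F, hF, hFm⟩ := hσ.coeff_mem l m
    exact ⟨⟨F, hF⟩, congrFun hFm⟩
  choose F hF using hlift
  let β := Module.finBasis k M
  -- Lifting only on a basis makes `s` linear. It is equivariant only after restriction to `H`, so
  -- the defect lies in `K`, which `Ψ` kills.
  let s : M →ₗ[k] 𝔾.coordRing := β.constr k fun i => F (β i)
  have hs : ∀ m (h : H.1), (s m : G → k) h = l (σ h m) := fun m h => by
    have : (𝔾.evalHom h).toLinearMap.comp s = l.comp (σ h) := β.ext fun i => by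
      simp [s, hF]
    exact LinearMap.congr_fun this m
  have := 𝔾.finiteDimensional_translateSpan (Set.finite_range fun i => F (β i))
  let K := 𝔾.translateSpan (Set.range fun i => F (β i)) ⊓ 𝔾.vanishingSubmodule H.1
  have : FiniteDimensional k K := Submodule.finiteDimensional_of_le inf_le_left
  have hsK : ∀ m, s m ∈ 𝔾.translateSpan (Set.range fun i => F (β i)) := fun m => by
    rw [← β.sum_repr m, map_sum]
    refine Submodule.sum_mem _ fun i _ => ?_
    rw [map_smul, β.constr_basis]
    exact Submodule.smul_mem _ _ (𝔾.subset_translateSpan _ ⟨i, rfl⟩)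
  obtain ⟨Ψ, hΨ, hΨK, hΨm⟩ := 𝔾.exists_equivariant_map_ne_zero hH K
    (fun h hh f hf => ⟨𝔾.translate_mem_translateSpan _ h hf.1,
      𝔾.translate_mem_vanishingSubmodule hh hf.2⟩) (u := s m)
    -- `s m` is outside `K` because its value at `1` is `l m ≠ 0`.
    (fun hsm => hl (by simpa using (hs m 1).symm.trans (hsm.2 1 H.1.one_mem)))
  refine ⟨Ψ.comp s, fun h m => ?_, hΨm⟩
  rw [LinearMap.comp_apply, LinearMap.comp_apply, hΨ h h.2, ← sub_eq_zero, ← map_sub]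
  refine hΨK _ ⟨Submodule.sub_mem _ (hsK _) (𝔾.translate_mem_translateSpan _ _ (hsK _)),
    fun y hy => ?_⟩
  have h1 := hs (σ h m) ⟨y, hy⟩
  have h2 := hs m (⟨y, hy⟩ * h)
  rw [map_mul, Module.End.mul_apply] at h2
  exact sub_eq_zero.2 (h1.trans h2.symm)

theorem isObservable_of_stab_fixedSubalgebra [IsAlgClosed k] [IsDomain 𝔾.coordRing]
    {H : 𝔾.ClosedSubgroup} (hH : 𝔾.stab (𝔾.fixedSubalgebra H) = H) : 𝔾.IsObservable H := by
  classical
  intro M _ _ _ σ hσ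
  let E := {Φ : M →ₗ[k] 𝔾.coordRing //
    ∀ (h : H.1) (m : M), Φ (σ h m) = 𝔾.translate h (Φ m)}
  -- As `M` is finite dimensional, finitely many equivariant maps already have zero common kernel.
  obtain ⟨t, ht⟩ := Finset.exists_inf_eq_iInf fun Φ : E => LinearMap.ker Φ.1
  have hker : ∀ m, (∀ Φ ∈ t, Φ.1 m = 0) → m = 0 := fun m hm => by
    by_contra hm₀
    obtain ⟨Φ, hΦ, hΦm⟩ := 𝔾.exists_equivariant_map_of_rational hH hσ hm₀
    have h1 : m ∈ t.inf fun Φ : E => LinearMap.ker Φ.1 := by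
      simpa [Submodule.mem_finsetInf] using hm
    rw [ht, Submodule.mem_iInf] at h1
    exact hΦm (h1 ⟨Φ, hΦ⟩)
  let e := t.equivFin
  let Φ : Fin t.card → M →ₗ[k] 𝔾.coordRing := fun i => (e.symm i).1.1
  have hΦ : ∀ i (h : H.1) m, Φ i (σ h m) = 𝔾.translate h (Φ i m) := fun i => (e.symm i).1.2
  let β := Module.finBasis k M
  let V := 𝔾.translateSpan (Set.range fun i : Fin t.card × Fin _ => Φ i.1 (β i.2))
  have : FiniteDimensional k V := 𝔾.finiteDimensional_translateSpan (Set.finite_range _)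
  have hΦV : ∀ i m, Φ i m ∈ V := fun i m => by
    rw [← β.sum_repr m, map_sum]
    refine Submodule.sum_mem _ fun j _ => ?_
    rw [map_smul]
    exact Submodule.smul_mem _ _ (𝔾.subset_translateSpan _ ⟨(i, j), rfl⟩)
  obtain ⟨d, w, hw, hspan⟩ := V.exists_fin_linearIndependent_span_eq
  obtain ⟨A, hApoly, hA⟩ := 𝔾.exists_matrix_translate hw (S := ⊤) fun x _ i => by
    rw [hspan]
    exact 𝔾.translate_mem_translateSpan _ x (hspan.le (Submodule.subset_span ⟨i, rfl⟩))
  let L : (Fin d → k) →ₗ[k] 𝔾.coordRing := Fintype.linearCombination k w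
  have hL : Function.Injective L := hw.fintypeLinearCombination_injective
  obtain ⟨c, hc⟩ := L.exists_leftInverse_of_injective (LinearMap.ker_eq_bot.2 hL)
  have hcL : ∀ v, c (L v) = v := LinearMap.congr_fun hc
  have hLc : ∀ f ∈ V, L (c f) = f := fun f hf => by
    rw [← hspan, ← Fintype.range_linearCombination] at hf
    obtain ⟨v, rfl⟩ := hf
    exact congrArg L (hcL v)
  have hLA : ∀ x v, 𝔾.translate x (L v) = L (Matrix.vecMul v (A x)) := fun x v => by
    simp only [L, Fintype.linearCombination_apply, map_sum, map_smul, hA x trivial,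
      Matrix.vecMul, dotProduct, Finset.smul_sum, Finset.sum_smul, smul_smul]
    exact Finset.sum_comm
  have hA₁ := 𝔾.matrix_translate_one hw hA
  have hAmul := fun x y => 𝔾.matrix_translate_mul hw hA (x := x) (y := y) trivial trivial
  have hinj : Function.Injective (LinearMap.pi fun i => c.comp (Φ i)) := by
    rw [injective_iff_map_eq_zero]
    intro m hm
    refine hker m fun Θ hΘ => ?_
    have h1 : c (Φ (e ⟨Θ, hΘ⟩) m) = 0 := congrFun hm (e ⟨Θ, hΘ⟩)
    have h2 := hLc _ (hΦV (e ⟨Θ, hΘ⟩) m)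
    rw [h1, map_zero] at h2
    simpa [Φ] using h2.symm
  -- This is a power of `V` written in the coordinates `w`, one row per map; matrices over `k` stay
  -- in the universe of `k`, as `IsObservable` demands.
  refine ⟨Matrix (Fin t.card) (Fin d) k, inferInstance, inferInstance, inferInstance,
    matrixRep _ A hA₁ hAmul, LinearMap.pi fun i => c.comp (Φ i),
    𝔾.isRational_matrixRep _ hA₁ hAmul hApoly, hinj, fun h m => funext fun i => ?_⟩
  change c (Φ i (σ h m)) = Matrix.vecMul (c (Φ i m)) (A h)
  rw [← hcL (Matrix.vecMul _ _), ← hLA, hLc _ (hΦV i m), hΦ]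

end AffineAlgebraicGroup

theorem theorem3p5 {k : Type u} [Field k] [IsAlgClosed k] {G : Type v} [Group G]
    (𝔾 : AffineAlgebraicGroup k G) (hG : 𝔾.IsConnected) :
    GaloisConnection
        (fun H : 𝔾.ClosedSubgroup => OrderDual.toDual (𝔾.fixedSubalgebra H))
        (fun R : (Subalgebra k 𝔾.coordRing)ᵒᵈ => 𝔾.stab (OrderDual.ofDual R)) ∧
      {H : 𝔾.ClosedSubgroup | 𝔾.stab (𝔾.fixedSubalgebra H) = H} =
        {H : 𝔾.ClosedSubgroup | 𝔾.IsObservable H} := by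
  have := 𝔾.isDomain_coordRing hG
  exact ⟨𝔾.galoisConnection_fixedSubalgebra_stab, Set.ext fun _ =>
    ⟨𝔾.isObservable_of_stab_fixedSubalgebra, fun h => h.stab_fixedSubalgebra⟩⟩
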